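/- Let $n \ge 2$ be even, let $a_1, \dots, a_n$ be positive integers, and let $G = (0^{a_1}1^{a_2}\cdots 0^{a_{n-1}}1^{a_n})$ be the connected threshold graph that is built by adding vertices one at a time according to this binary sequence, where a digit $0$ adds an isolated vertex and a digit $1$ adds a vertex adjacent to all the earlier ones. Let $P_G(x) = \det(A - xI)$, with $A$ the adjacency matrix of $G$, and let $m_0(G)$ and $m_{-1}(G)$ be the multiplicities of the eigenvalues $0$ and $-1$ of $G$. For $0 \le l \le n$ let $I_{n,l}$ be the set of increasing sequences $t = (t_1 < \dots < t_l)$ in $\{1, \dots, n\}$ with $t_i \equiv n + i - l \pmod 2$ for all $i$, and put $\gamma_n(l) = \sum_{t \in I_{n,l}} a_{t_1} \cdots a_{t_l}$ for $l \ge 1$ and $\gamma_n(0) = 1$. Write $n = 2m + r_0$ with $r_0 \in \{0,1\}$, let $r_1 = 1 - r_0$ and $y = x + 1$, and define $$Q_n(x) = x^{r_0} \sum_{k=0}^{m} (-1)^{m-k} x^k y^k \gamma_n(n - 2k - r_0) + x^{r_1} \sum_{k=0}^{m - r_1} (-1)^{m-k} x^k y^k \gamma_n(n - 2k - r_1).$$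 If $a_1 > 1$, then $$P_G(x) = (-1)^{\sum_i a_i}\, x^{m_0(G)} (x+1)^{m_{-1}(G)}\, Q_n(x).$$ If $a_1 = 1$, then $m_{-1}(G) \ge 1$ and $$P_G(x) = (-1)^{\sum_i a_i}\, x^{m_0(G)} (x+1)^{m_{-1}(G) - 1}\, Q_n(x).$$ -/

import Mathlib

open Polynomial

noncomputable section

/-- The graph built from the vertices of a finite linear order, added in increasing order: a vertex
with digit `true` (that is, `1`) is added as a dominating vertex, a vertex with digit `false`
(that is, `0`) is added as an isolated vertex.  So two distinct vertices are adjacent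
exactly when the later one of them has digit `1`. -/
def creationGraph {V : Type*} [LinearOrder V] (digit : V → Bool) : SimpleGraph V where
  Adj u v := u ≠ v ∧ digit (max u v) = true
  symm := ⟨fun u v h => ⟨h.1.symm, by rw [max_comm]; exact h.2⟩⟩
  loopless := ⟨fun _ h => h.1 rfl⟩

/-- The positions of the binary sequence `0^{a 1} 1^{a 2} 0^{a 3} 1^{a 4} ⋯` with `n` blocks, in
their order: pairs (block, position inside the block), ordered lexicographically. The
element `i : Fin n` stands for the block with number `i + 1`. -/
abbrev BlockPos (n : ℕ) (a : ℕ → ℕ) : Type := Σₗ i : Fin n, Fin (a (i.val + 1))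

/-- The digits of `0^{a 1} 1^{a 2} 0^{a 3} 1^{a 4} ⋯`: blocks with even number consist of ones. -/
def blockDigit (n : ℕ) (a : ℕ → ℕ) (v : BlockPos n a) : Bool :=
  decide (Even ((ofLex v).1.val + 1))

/-- The threshold graph `(0^{a 1} 1^{a 2} 0^{a 3} 1^{a 4} ⋯)` with `n` blocks. -/
def thresholdGraph (n : ℕ) (a : ℕ → ℕ) : SimpleGraph (BlockPos n a) :=
  creationGraph (blockDigit n a)

/-- `P_G(x) = det (A - x I)`, with `A` the adjacency matrix of `G`. -/
def graphPoly {V : Type*} [Fintype V] [DecidableEq V] (G : SimpleGraph V) [DecidableRel G.Adj] :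
    ℝ[X] :=
  ((G.adjMatrix ℝ).map (C : ℝ → ℝ[X]) - (X : ℝ[X]) • (1 : Matrix V V ℝ[X])).det

/-- The multiplicity of the real number `r` as an eigenvalue of `G`. -/
def eigMult {V : Type*} [Fintype V] [DecidableEq V] (G : SimpleGraph V) [DecidableRel G.Adj]
    (r : ℝ) : ℕ :=
  (graphPoly G).rootMultiplicity r

open Classical in
/-- The increasing sequences `(t_1, …, t_l)` in `{1, …, n}` with `t_i ≡ n + i - l (mod 2)` for
all `i`; `t i` for `i : Fin l` stands for the term with number `i + 1`. -/
def altSeqs (n l : ℕ) : Finset (Fin l → ℕ) :=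
  (Fintype.piFinset fun _ : Fin l => Finset.Icc 1 n).filter fun t =>
    StrictMono t ∧ ∀ i : Fin l, (t i : ℤ) ≡ (n : ℤ) + ((i.val : ℤ) + 1) - (l : ℤ) [ZMOD 2]

/-- `γ_n(l)`, the sum of `a_{t_1} ⋯ a_{t_l}` over the alternating sequences of length `l`. -/
def gammaSum (a : ℕ → ℕ) (n l : ℕ) : ℕ :=
  ∑ t ∈ altSeqs n l, ∏ i : Fin l, a (t i)

theorem gammaSum_zero (a : ℕ → ℕ) (n : ℕ) : gammaSum a n 0 = 1 := by
  have h : altSeqs n 0 = {default} := by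
    ext t
    obtain rfl : t = default := Subsingleton.elim _ _
    simp [altSeqs, Subsingleton.strictMono]
    exact Subsingleton.elim _ _
  simp [gammaSum, h]

/-- `Q_n(x)`, where `n = 2 m + r₀` with `r₀ ∈ {0, 1}`, `r₁ = 1 - r₀`, and `y = x + 1`. -/
def Qpoly (a : ℕ → ℕ) (n : ℕ) : ℝ[X] :=
  let m := n / 2
  let r₀ := n % 2
  let r₁ := (n + 1) % 2
  X ^ r₀ * (∑ k ∈ Finset.range (m + 1),
      (-1 : ℝ[X]) ^ (m - k) * X ^ k * (X + 1) ^ k * C (gammaSum a n (n - 2 * k - r₀) : ℝ)) +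
  X ^ r₁ * (∑ k ∈ Finset.range (m - r₁ + 1),
      (-1 : ℝ[X]) ^ (m - k) * X ^ k * (X + 1) ^ k * C (gammaSum a n (n - 2 * k - r₁) : ℝ))

end

/-!
Write `J` for the all-ones matrix and consider `f_n(s) = det (X - A + s J)` for the graph with `n`
blocks. Appending a block of `k` vertices with digit `e` borders the matrix by constant entries
`-(e - s)`, and row operations (`det_borderBlock`) give, with `d = X + e`,
`f_{n+1}(s) = d ^ (k - 1) * (d * f_n(s) - k * (e - s) * f_n(e))`.
So carrying the parameter `s` closes the recursion, and only `s = 0` and `s = 1` occur in it. The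
factors `d ^ (k - 1)` split off as `X ^ p * (X + 1) ^ q`; what remains is `reducedDet`.

Choosing `s` by the parity of `n` turns `reducedDet` into a sequence `h_n` (`mainDet`) with
`h_{n+2} = X (X + 1) h_n - (-1) ^ n a_{n+2} h_{n+1}`. An alternating sequence in `{1, …, n+1}`
either ends in `n + 1` or, by parity, stays below `n`; hence
`γ_{n+1}(l+1) = a_{n+1} γ_n(l) + γ_{n-1}(l+1)` (`gammaSum_succ_succ`), which is the same recursion
for the coefficients of `Qpoly`, so `Qpoly a n = h_n` for even `n ≥ 2`.

At `0` and at `-1` the term `X (X + 1) h_n` vanishes, so there `h_n` is, up to sign, a product of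
the `a_i` with the value of `h_1 = X + a_1`. Hence `h_n(0) ≠ 0` always, and `h_n(-1) ≠ 0` if
`a_1 > 1`. If `a_1 = 1`, all `h_n` with `n ≥ 1` are divisible by `X + 1`, and the same recursion
for the quotients shows that `-1` is a simple root. The multiplicities of `0` and `-1` can thus be
read off from the factorization.
-/

/-! ### Alternating sequences -/

theorem mem_altSeqs {n l : ℕ} {t : Fin l → ℕ} :
    t ∈ altSeqs n l ↔ (∀ i, 1 ≤ t i ∧ t i ≤ n) ∧ StrictMono t ∧
      ∀ i : Fin l, (t i : ℤ) ≡ (n : ℤ) + ((i.val : ℤ) + 1) - (l : ℤ) [ZMOD 2] := by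
  simp [altSeqs]

theorem snoc_mem_altSeqs {n l : ℕ} {s : Fin l → ℕ} :
    (Fin.snoc s (n + 1) : Fin (l + 1) → ℕ) ∈ altSeqs (n + 1) (l + 1) ↔ s ∈ altSeqs n l := by
  simp only [mem_altSeqs, Fin.forall_fin_succ', Fin.snoc_castSucc, Fin.snoc_last]
  constructor
  · rintro ⟨⟨h1, -⟩, h2, h3, -⟩
    refine ⟨fun i => ⟨(h1 i).1, ?_⟩, fun i j hij => ?_, fun i => ?_⟩
    · have := h2 (Fin.castSucc_lt_last i)
      simp only [Fin.snoc_castSucc, Fin.snoc_last] at this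
      omega
    · simpa using h2 (Fin.castSucc_lt_castSucc_iff.2 hij)
    · have := h3 i
      simp only [Int.ModEq, Fin.val_castSucc] at this ⊢
      push_cast at this
      omega
  · rintro ⟨h1, h2, h3⟩
    refine ⟨⟨fun i => ⟨(h1 i).1, by have := (h1 i).2; omega⟩, by omega, le_rfl⟩, ?_, ?_, ?_⟩
    · refine Fin.strictMono_iff_lt_succ.2 fun i => ?_
      rcases i with ⟨i, hi⟩
      by_cases h : i + 1 < l
      · have e1 : (⟨i, hi⟩ : Fin l).succ = Fin.castSucc ⟨i + 1, h⟩ := rfl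
        rw [e1, Fin.snoc_castSucc, Fin.snoc_castSucc]
        exact h2 (by simp [Fin.lt_def])
      · have e1 : (⟨i, hi⟩ : Fin l).succ = Fin.last l := by ext; simp; omega
        rw [e1, Fin.snoc_castSucc, Fin.snoc_last]
        have := (h1 ⟨i, hi⟩).2
        omega
    · intro i
      have := h3 i
      simp only [Int.ModEq, Fin.val_castSucc] at this ⊢
      push_cast
      omega
    · simp only [Int.ModEq, Fin.val_last]
      push_cast
      omega

/-- Sequences are sorted by whether their last term is `n + 1`. For `n = 0` the truncated `n - 1` is
harmless, as `{1, …, n}` and `{1, …, n - 1}` are then both empty. -/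
theorem gammaSum_succ_succ (a : ℕ → ℕ) (n l : ℕ) :
    gammaSum a (n + 1) (l + 1) = a (n + 1) * gammaSum a n l + gammaSum a (n - 1) (l + 1) := by
  unfold gammaSum
  rw [← Finset.sum_filter_add_sum_filter_not _ (fun t => t (Fin.last l) = n + 1)]
  congr 1
  · rw [Finset.mul_sum]
    refine Finset.sum_bij' (fun t _ => Fin.init t) (fun s _ => Fin.snoc s (n + 1)) ?_ ?_ ?_ ?_ ?_
    · intro t ht
      rw [Finset.mem_filter] at ht
      rw [← snoc_mem_altSeqs, ← ht.2, Fin.snoc_init_self, ht.2]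
      exact ht.1
    · intro s hs
      rw [Finset.mem_filter]
      exact ⟨snoc_mem_altSeqs.2 hs, Fin.snoc_last _ _⟩
    · intro t ht
      rw [← (Finset.mem_filter.1 ht).2, Fin.snoc_init_self]
    · intro s _
      exact Fin.init_snoc _ _
    · intro t ht
      rw [Fin.prod_univ_castSucc, (Finset.mem_filter.1 ht).2, mul_comm]
      rfl
  · refine Finset.sum_congr ?_ fun _ _ => rfl
    ext t
    simp only [Finset.mem_filter, mem_altSeqs, Int.ModEq]
    constructor
    · rintro ⟨⟨h1, h2, h3⟩, h4⟩
      have hl := h3 (Fin.last l)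
      have hb := h1 (Fin.last l)
      rw [Fin.val_last] at hl
      push_cast at hl
      -- The last term has the parity of `n + 1` and is not `n + 1`, so it is at most `n - 1`.
      have hb' : t (Fin.last l) ≤ n - 1 := by omega
      refine ⟨fun i => ⟨(h1 i).1, (h2.monotone (Fin.le_last i)).trans hb'⟩, h2, fun i => ?_⟩
      have := h3 i
      push_cast at this ⊢
      omega
    · rintro ⟨h1, h2, h3⟩
      have hb := h1 (Fin.last l)
      refine ⟨⟨fun i => ⟨(h1 i).1, by have := (h1 i).2; omega⟩, h2, fun i => ?_⟩, by omega⟩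
      have := h3 i
      push_cast at this ⊢
      omega

theorem gammaSum_eq_zero (a : ℕ → ℕ) {n l : ℕ} (h : n < l) : gammaSum a n l = 0 := by
  refine Finset.sum_eq_zero fun t ht => ?_
  obtain ⟨h1, h2, -⟩ := mem_altSeqs.1 ht
  have := Finset.card_le_card_of_injOn t (s := Finset.univ) (t := Finset.Icc 1 n)
    (by intro i _; simpa using h1 i) h2.injective.injOn
  simp at this
  omega

/-! ### Determinants of bordered matrices -/

open Matrix in
/-- Bordering by one row and column: the new row is the sum of `d` times a unit vector and `-c`
times the all-ones vector, and row operations clear the border in the second summand. -/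
theorem det_border {α R : Type*} [Fintype α] [DecidableEq α] [CommRing R] (M : Matrix α α R)
    (c d : R) :
    (fromBlocks M (of fun _ _ => -c) (of fun _ _ => -c)
        (of fun _ _ => d - c) : Matrix (α ⊕ Fin 1) (α ⊕ Fin 1) R).det =
      d * M.det - c * (M + of fun _ _ => c).det := by
  set B : Matrix (α ⊕ Fin 1) (α ⊕ Fin 1) R :=
    fromBlocks M (of fun _ _ => -c) (of fun _ _ => -c) (of fun _ _ => d - c) with hB
  have h0 : B = B.updateRow (Sum.inr 0)
      (Sum.elim (fun _ => 0) (fun _ => d) + fun _ => -c) := by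
    ext (i | i) (j | j) <;> simp [hB, updateRow_apply, Fin.fin_one_eq_zero, sub_eq_add_neg]
  have h1 : B.updateRow (Sum.inr 0) (Sum.elim (fun _ => 0) (fun _ => d)) =
      fromBlocks M (of fun _ _ => -c) 0 (of fun _ _ => d) := by
    ext (i | i) (j | j) <;> simp [hB, updateRow_apply, Fin.fin_one_eq_zero]
  have h2 : B.updateRow (Sum.inr 0) (fun _ => -c) =
      fromBlocks 1 (of fun _ _ => 1) 0 1 *
        fromBlocks (M + of fun _ _ => c) 0 (of fun _ _ => -c) (of fun _ _ => -c) := by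
    rw [fromBlocks_multiply]
    ext (i | i) (j | j) <;>
      simp [hB, updateRow_apply, Fin.fin_one_eq_zero, Matrix.mul_apply]
  rw [h0, det_updateRow_add, h1, h2, det_mul, det_fromBlocks_zero₂₁, det_fromBlocks_zero₂₁,
    det_fromBlocks_zero₁₂]
  simp
  ring

open Matrix in
/-- Adding `c` to every entry of the bordered matrix clears the border, so the second determinant in
`det_border` is explicit at each step of the induction on the size of the new block. -/
theorem det_borderBlock {α R : Type*} [Fintype α] [DecidableEq α] [CommRing R]
    (M : Matrix α α R) (c d : R) (k : ℕ) :
    (fromBlocks M (of fun _ _ => -c) (of fun _ _ => -c)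
        (of fun i j => (if i = j then d else 0) - c) :
          Matrix (α ⊕ Fin (k + 1)) (α ⊕ Fin (k + 1)) R).det =
      d ^ k * (d * M.det - (k + 1 : ℕ) * c * (M + of fun _ _ => c).det) := by
  induction k with
  | zero =>
    have h := det_border M c d
    simp only [zero_add, pow_zero, one_mul, Nat.cast_one]
    rw [← h]
    congr 1
    ext (i | i) (j | j) <;> simp [Fin.fin_one_eq_zero]
  | succ k ih =>
    let e : (α ⊕ Fin (k + 1)) ⊕ Fin 1 ≃ α ⊕ Fin (k + 1 + 1) :=
      (Equiv.sumAssoc α (Fin (k + 1)) (Fin 1)).trans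
        (Equiv.sumCongr (Equiv.refl α) finSumFinEquiv)
    rw [← det_submatrix_equiv_self e]
    set B : Matrix (α ⊕ Fin (k + 1)) (α ⊕ Fin (k + 1)) R :=
      fromBlocks M (of fun _ _ => -c) (of fun _ _ => -c)
        (of fun i j => (if i = j then d else 0) - c) with hB
    have h1 := det_border B c d
    have h2 : B + (of fun _ _ => c) =
        fromBlocks (M + of fun _ _ => c) 0 0 (diagonal fun _ => d) := by
      ext (i | i) (j | j) <;> simp [hB, diagonal_apply]
    rw [h2, det_fromBlocks_zero₂₁, det_diagonal, ih] at h1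
    refine Eq.trans (congrArg det ?_) (h1.trans ?_)
    · ext ((i | i) | i) ((j | j) | j) <;>
        simp [hB, e, Fin.fin_one_eq_zero, Fin.ext_iff] <;> omega
    · simp
      ring

/-! ### The determinant of the threshold graph -/

/-- The binary digit of block number `j`, as a polynomial. -/
noncomputable def digitPoly (j : ℕ) : ℝ[X] := if Even j then 1 else 0

/-- The recursion that the determinants of `shiftedMatrix a n s` obey once the factors coming from
repeated vertices are removed. -/
noncomputable def reducedDet (a : ℕ → ℕ) : ℕ → ℝ[X] → ℝ[X]
  | 0, _ => 1
  | n + 1, s => (X + digitPoly (n + 1)) * reducedDet a n s -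
      (a (n + 1) : ℝ[X]) * (digitPoly (n + 1) - s) * reducedDet a n (digitPoly (n + 1))

/-- The matrix `X - A + s J` of the threshold graph with `n` blocks, where `J` is the all-ones
matrix and `s` a scalar parameter.  An edge depends on the later block only, and inside a block of
ones the diagonal entry `X` is written as `(X + 1) - 1`. -/
noncomputable def shiftedMatrix (a : ℕ → ℕ) (n : ℕ) (s : ℝ[X]) :
    Matrix (Σ i : Fin n, Fin (a (i.val + 1))) (Σ i : Fin n, Fin (a (i.val + 1))) ℝ[X] :=
  Matrix.of fun u v => (if u = v then X + digitPoly (u.1.val + 1) else 0) -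
    (digitPoly (max u.1.val v.1.val + 1) - s)

/-- A sequence of `n + 1` blocks is a sequence of `n` blocks followed by a last block. -/
noncomputable def blockSuccEquiv (b : ℕ → ℕ) (n : ℕ) :
    (Σ i : Fin n, Fin (b i.val)) ⊕ Fin (b n) ≃ Σ i : Fin (n + 1), Fin (b i.val) :=
  Equiv.ofBijective
    (Sum.elim (fun u => ⟨u.1.castSucc, u.2⟩) fun j => ⟨Fin.last n, j⟩) <| by
    constructor
    · rintro (⟨i, p⟩ | p) (⟨j, q⟩ | q) h
      · simp only [Sum.elim_inl, Sigma.mk.injEq, Fin.castSucc_inj] at h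
        obtain ⟨rfl, h⟩ := h
        rw [eq_of_heq h]
      · exact absurd (congrArg Sigma.fst h) (Fin.castSucc_ne_last i)
      · exact absurd (congrArg Sigma.fst h) (Fin.castSucc_ne_last j).symm
      · simpa using h
    · rintro ⟨i, p⟩
      induction i using Fin.lastCases with
      | last => exact ⟨Sum.inr p, rfl⟩
      | cast i => exact ⟨Sum.inl ⟨i, p⟩, rfl⟩

theorem blockSuccEquiv_inl_fst (b : ℕ → ℕ) (n : ℕ) (u : Σ i : Fin n, Fin (b i.val)) :
    (blockSuccEquiv b n (Sum.inl u)).1.val = u.1.val := rfl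

theorem blockSuccEquiv_inr_fst (b : ℕ → ℕ) (n : ℕ) (j : Fin (b n)) :
    (blockSuccEquiv b n (Sum.inr j)).1.val = n := rfl

open Matrix in
theorem det_shiftedMatrix (a : ℕ → ℕ) (n : ℕ) (ha : ∀ i, 1 ≤ i → i ≤ n → 0 < a i) (s : ℝ[X]) :
    (shiftedMatrix a n s).det =
      (∏ i ∈ Finset.range n, (X + digitPoly (i + 1)) ^ (a (i + 1) - 1)) * reducedDet a n s := by
  induction n generalizing s with
  | zero => simp [reducedDet]
  | succ n ih =>
    have ih' := ih fun i h1 h2 => ha i h1 (by omega)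
    obtain ⟨k, hk⟩ : ∃ k, a (n + 1) = k + 1 :=
      Nat.exists_eq_add_one.2 (ha (n + 1) (by omega) le_rfl)
    let e := (Equiv.sumCongr (Equiv.refl (Σ i : Fin n, Fin (a (i.val + 1))))
      (finCongr hk.symm)).trans (blockSuccEquiv (fun i => a (i + 1)) n)
    rw [← det_submatrix_equiv_self e]
    have h1 := det_borderBlock (shiftedMatrix a n s) (digitPoly (n + 1) - s)
      (X + digitPoly (n + 1)) k
    have h2 : shiftedMatrix a n s + (of fun _ _ => digitPoly (n + 1) - s) =
        shiftedMatrix a n (digitPoly (n + 1)) := by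
      ext1 u v
      simp only [shiftedMatrix, Matrix.add_apply, of_apply]
      ring
    rw [h2, ih', ih'] at h1
    refine Eq.trans (congrArg det ?_) (h1.trans ?_)
    · ext1 u v
      rw [submatrix_apply, shiftedMatrix, of_apply]
      -- Equality of positions is tested before `e` is unfolded.
      simp only [e.injective.eq_iff]
      rcases u with u | i <;> rcases v with v | j
      · simp [e, blockSuccEquiv_inl_fst, shiftedMatrix]
      · simp [e, blockSuccEquiv_inl_fst, blockSuccEquiv_inr_fst]
      · simp [e, blockSuccEquiv_inl_fst, blockSuccEquiv_inr_fst]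
      · simp [e, blockSuccEquiv_inr_fst]
    · rw [Finset.prod_range_succ, reducedDet, hk]
      simp only [Nat.add_sub_cancel]
      ring

theorem thresholdGraph_adj {n : ℕ} {a : ℕ → ℕ} {u v : BlockPos n a} :
    (thresholdGraph n a).Adj u v ↔
      u ≠ v ∧ Even (max (ofLex u).1.val (ofLex v).1.val + 1) := by
  have key : (ofLex (max u v)).1.val = max (ofLex u).1.val (ofLex v).1.val := by
    have mono : ∀ {u v : BlockPos n a}, u ≤ v → (ofLex u).1.val ≤ (ofLex v).1.val := by
      intro u v h
      rcases Sigma.Lex.le_def.1 h with h | ⟨h, -⟩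
      · exact h.le
      · exact (congrArg Fin.val h).le
    rcases le_total u v with h | h
    · rw [max_eq_right h, max_eq_right (mono h)]
    · rw [max_eq_left h, max_eq_left (mono h)]
  simp only [thresholdGraph, creationGraph, blockDigit, decide_eq_true_eq, key]

theorem card_blockPos (n : ℕ) (a : ℕ → ℕ) :
    Fintype.card (Σ i : Fin n, Fin (a (i.val + 1))) = ∑ i ∈ Finset.Icc 1 n, a i := by
  rw [Fintype.card_sigma]
  simp only [Fintype.card_fin]
  rw [Fin.sum_univ_eq_sum_range (fun i => a (i + 1)) n, Finset.range_eq_Ico,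
    Finset.sum_Ico_add' a 0 n 1]
  rfl

open Matrix in
theorem graphPoly_eq {n : ℕ} {a : ℕ → ℕ} (ha : ∀ i, 1 ≤ i → i ≤ n → 0 < a i)
    {V : Type*} [Fintype V] [DecidableEq V] {G : SimpleGraph V} [DecidableRel G.Adj]
    (e : G ≃g thresholdGraph n a) :
    graphPoly G = (-1) ^ (∑ i ∈ Finset.Icc 1 n, a i) *
      ((∏ i ∈ Finset.range n, (X + digitPoly (i + 1)) ^ (a (i + 1) - 1)) *
        reducedDet a n 0) := by
  let f : V ≃ Σ i : Fin n, Fin (a (i.val + 1)) := e.toEquiv.trans ofLex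
  have h : (G.adjMatrix ℝ).map (C : ℝ → ℝ[X]) - (X : ℝ[X]) • (1 : Matrix V V ℝ[X]) =
      -(shiftedMatrix a n 0).submatrix f f := by
    ext1 u v
    have hadj : G.Adj u v ↔ u ≠ v ∧ Even (max (f u).1.val (f v).1.val + 1) := by
      rw [← e.map_adj_iff, thresholdGraph_adj, e.injective.ne_iff]
      rfl
    by_cases huv : u = v
    · subst huv
      simp [shiftedMatrix]
    · by_cases hev : Even (max (f u).1.val (f v).1.val + 1) <;>
        simp [shiftedMatrix, digitPoly, SimpleGraph.adjMatrix_apply, hadj, huv, hev]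
  rw [graphPoly, h, det_neg, det_submatrix_equiv_self, det_shiftedMatrix a n ha,
    Fintype.card_congr f, card_blockPos]

theorem exists_prod_eq (a : ℕ → ℕ) (n : ℕ) : ∃ s t : ℕ,
    ∏ i ∈ Finset.range n, (X + digitPoly (i + 1)) ^ (a (i + 1) - 1) =
      X ^ s * (X + 1 : ℝ[X]) ^ t := by
  induction n with
  | zero => exact ⟨0, 0, by simp⟩
  | succ n ih =>
    obtain ⟨s, t, h⟩ := ih
    rw [Finset.prod_range_succ, h, digitPoly]
    split_ifs
    · exact ⟨s, t + (a (n + 1) - 1), by ring⟩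
    · exact ⟨s + (a (n + 1) - 1), t, by ring⟩

/-! ### The determinant at the parameter fixed by parity -/

/-- `reducedDet` at the parameter fixed by parity: `0` for even `n`, `1` for odd `n`. -/
noncomputable def mainDet (a : ℕ → ℕ) (n : ℕ) : ℝ[X] := reducedDet a n (digitPoly (n + 1))

theorem mainDet_zero (a : ℕ → ℕ) : mainDet a 0 = 1 := rfl

theorem mainDet_one (a : ℕ → ℕ) : mainDet a 1 = X + (a 1 : ℝ[X]) := by
  simp [mainDet, reducedDet, digitPoly]

theorem mainDet_two_mul (a : ℕ → ℕ) (m : ℕ) : mainDet a (2 * m) = reducedDet a (2 * m) 0 := by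
  have : ¬ Even (2 * m + 1) := by simp
  rw [mainDet, digitPoly, if_neg this]

/-- The parameter of `mainDet a (n + 2)` is the digit of block `n + 1`, so the correction term of
that block vanishes and the two linear factors combine to `X * (X + 1)`. -/
theorem mainDet_add_two (a : ℕ → ℕ) (n : ℕ) :
    mainDet a (n + 2) = X * (X + 1) * mainDet a n -
      (-1) ^ n * (a (n + 2) : ℝ[X]) * mainDet a (n + 1) := by
  have h3 : digitPoly (n + 3) = digitPoly (n + 1) := by
    simp [digitPoly, show n + 3 = n + 1 + 2 from rfl, Nat.even_add, parity_simps]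
  simp only [mainDet, h3, reducedDet]
  rcases Nat.even_or_odd n with h | h
  · have h1 : digitPoly (n + 1) = 0 := if_neg (by simpa using h.add_one)
    have h2 : digitPoly (n + 2) = 1 := if_pos (h.add even_two)
    rw [h1, h2, h.neg_one_pow]
    ring
  · have h1 : digitPoly (n + 1) = 1 := if_pos h.add_one
    have h2 : digitPoly (n + 2) = 0 := if_neg (by simpa using h.add_even even_two)
    rw [h1, h2, h.neg_one_pow]
    ring

/-! ### Comparison with `Qpoly` -/

/-- The part of `Qpoly` built from the `γ_n(l)` with even `l ≤ 2 m`, indexed by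
`j = l / 2`; the factor `X` that it carries in `Qpoly` for odd `n` is left out. -/
noncomputable def evenSum (a : ℕ → ℕ) (n m : ℕ) : ℝ[X] :=
  ∑ j ∈ Finset.range (m + 1), (-1) ^ j * (X * (X + 1)) ^ (m - j) * (gammaSum a n (2 * j) : ℝ[X])

/-- The part of `Qpoly` built from the `γ_n(l)` with odd `l < 2 m`, indexed by `j` with
`l = 2 j + 1`; the factor `-X` that it carries in `Qpoly` for even `n` is left out. -/
noncomputable def oddSum (a : ℕ → ℕ) (n m : ℕ) : ℝ[X] :=
  ∑ j ∈ Finset.range m,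
    (-1) ^ j * (X * (X + 1)) ^ (m - 1 - j) * (gammaSum a n (2 * j + 1) : ℝ[X])

theorem evenSum_succ_of_lt (a : ℕ → ℕ) {n m : ℕ} (h : n < 2 * m + 2) :
    evenSum a n (m + 1) = X * (X + 1) * evenSum a n m := by
  rw [evenSum, Finset.sum_range_succ, gammaSum_eq_zero a (show n < 2 * (m + 1) by omega),
    evenSum, Finset.mul_sum]
  simp only [Nat.cast_zero, mul_zero, add_zero]
  refine Finset.sum_congr rfl fun j hj => ?_
  rw [show m + 1 - j = m - j + 1 by have := Finset.mem_range.1 hj; omega, pow_succ]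
  ring

theorem oddSum_succ_of_lt (a : ℕ → ℕ) {n m : ℕ} (h : n < 2 * m + 1) :
    oddSum a n (m + 1) = X * (X + 1) * oddSum a n m := by
  rw [oddSum, Finset.sum_range_succ, gammaSum_eq_zero a h, oddSum, Finset.mul_sum]
  simp only [Nat.cast_zero, mul_zero, add_zero]
  refine Finset.sum_congr rfl fun j hj => ?_
  rw [show m + 1 - 1 - j = m - 1 - j + 1 by have := Finset.mem_range.1 hj; omega, pow_succ]
  ring

theorem evenSum_add_two (a : ℕ → ℕ) {n m : ℕ} (h : n < 2 * m + 2) :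
    evenSum a (n + 2) (m + 1) =
      X * (X + 1) * evenSum a n m - (a (n + 2) : ℝ[X]) * oddSum a (n + 1) (m + 1) := by
  rw [← evenSum_succ_of_lt a h]
  simp only [evenSum, oddSum]
  rw [Finset.sum_range_succ', Finset.sum_range_succ' _ (m + 1), Finset.mul_sum, add_sub_right_comm,
    ← Finset.sum_sub_distrib]
  simp only [Nat.mul_zero, gammaSum_zero]
  congr 1
  refine Finset.sum_congr rfl fun j _ => ?_
  rw [show 2 * (j + 1) = 2 * j + 1 + 1 by ring, gammaSum_succ_succ a (n + 1) (2 * j + 1),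
    show m + 1 - (j + 1) = m + 1 - 1 - j by omega]
  push_cast
  ring

theorem oddSum_add_two (a : ℕ → ℕ) {n m : ℕ} (h : n < 2 * m + 1) :
    oddSum a (n + 2) (m + 1) =
      X * (X + 1) * oddSum a n m + (a (n + 2) : ℝ[X]) * evenSum a (n + 1) m := by
  rw [← oddSum_succ_of_lt a h]
  simp only [evenSum, oddSum]
  rw [Finset.mul_sum, ← Finset.sum_add_distrib]
  refine Finset.sum_congr rfl fun j _ => ?_
  rw [gammaSum_succ_succ a (n + 1) (2 * j)]
  push_cast
  ring

theorem mainDet_eq_sums (a : ℕ → ℕ) (m : ℕ) :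
    mainDet a (2 * m) = evenSum a (2 * m) m - X * oddSum a (2 * m) m ∧
    mainDet a (2 * m + 1) =
      X * evenSum a (2 * m + 1) m + oddSum a (2 * m + 1) (m + 1) := by
  induction m with
  | zero =>
    have h : gammaSum a 1 1 = a 1 := by
      simpa [gammaSum_zero, gammaSum_eq_zero] using gammaSum_succ_succ a 0 0
    simp [mainDet_zero, mainDet_one, evenSum, oddSum, gammaSum_zero, h]
  | succ m ih =>
    have he : (-1 : ℝ[X]) ^ (2 * m) = 1 := (even_two_mul m).neg_one_pow
    have ho : (-1 : ℝ[X]) ^ (2 * m + 1) = -1 := (odd_two_mul_add_one m).neg_one_pow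
    have h1 : mainDet a (2 * (m + 1)) =
        evenSum a (2 * (m + 1)) (m + 1) - X * oddSum a (2 * (m + 1)) (m + 1) := by
      rw [show 2 * (m + 1) = 2 * m + 2 by ring, mainDet_add_two, ih.1, ih.2, he,
        evenSum_add_two a (by omega), oddSum_add_two a (by omega)]
      ring
    refine ⟨h1, ?_⟩
    rw [show 2 * (m + 1) = 2 * m + 2 by ring] at h1 ⊢
    rw [show 2 * m + 2 + 1 = 2 * m + 1 + 2 by ring, mainDet_add_two, ho, ih.2,
      evenSum_add_two a (by omega),
      oddSum_add_two a (n := 2 * m + 1) (m := m + 1) (by omega),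
      show 2 * m + 1 + 1 = 2 * m + 2 by ring, h1]
    ring

/-- The case of zero blocks is excluded: there the second sum of `Qpoly` has a spurious term, because
`m - r₁` is truncated. -/
theorem Qpoly_two_mul (a : ℕ → ℕ) (m : ℕ) :
    Qpoly a (2 * (m + 1)) = reducedDet a (2 * (m + 1)) 0 := by
  rw [← mainDet_two_mul, (mainDet_eq_sums a (m + 1)).1, Qpoly]
  simp only [show 2 * (m + 1) / 2 = m + 1 by omega, show 2 * (m + 1) % 2 = 0 by omega,
    show (2 * (m + 1) + 1) % 2 = 1 by omega, pow_zero, one_mul, pow_one, Nat.add_sub_cancel,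
    Nat.sub_zero]
  rw [sub_eq_add_neg, ← mul_neg]
  congr 1
  · rw [evenSum, ← Finset.sum_range_reflect]
    refine Finset.sum_congr rfl fun j hj => ?_
    have := Finset.mem_range.1 hj
    rw [show m + 1 + 1 - 1 - j = m + 1 - j by omega, show m + 1 - (m + 1 - j) = j by omega,
      show 2 * (m + 1) - 2 * (m + 1 - j) = 2 * j by omega, mul_pow, map_natCast]
    ring
  · congr 1
    rw [oddSum, ← Finset.sum_range_reflect, ← Finset.sum_neg_distrib]
    refine Finset.sum_congr rfl fun j hj => ?_
    have := Finset.mem_range.1 hj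
    rw [show m + 1 - 1 - j = m - j by omega, show m + 1 - (m - j) = j + 1 by omega,
      show 2 * (m + 1) - 2 * (m - j) - 1 = 2 * j + 1 by omega, mul_pow, pow_succ, map_natCast]
    ring

/-! ### Values at `0` and `-1`, and the multiplicities -/

theorem eval_zero_mainDet_ne_zero {a : ℕ → ℕ} {n : ℕ} (ha : ∀ i, 1 ≤ i → i ≤ n → 0 < a i) :
    (mainDet a n).eval 0 ≠ 0 := by
  induction n with
  | zero => simp [mainDet_zero]
  | succ n ih =>
    have h := ih fun i h1 h2 => ha i h1 (by omega)
    have hp := (ha (n + 1) (by omega) le_rfl).ne'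
    cases n with
    | zero => simpa [mainDet_one] using hp
    | succ n => simpa [mainDet_add_two, h] using hp

theorem eval_neg_one_mainDet_ne_zero {a : ℕ → ℕ} {n : ℕ}
    (ha : ∀ i, 1 ≤ i → i ≤ n + 1 → 0 < a i) (h1 : 1 < a 1) :
    (mainDet a (n + 1)).eval (-1) ≠ 0 := by
  induction n with
  | zero =>
    have : (1 : ℝ) < a 1 := by exact_mod_cast h1
    simp [mainDet_one]
    linarith
  | succ n ih =>
    have h := ih fun i h1 h2 => ha i h1 (by omega)
    have hp := (ha (n + 2) (by omega) le_rfl).ne'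
    simpa [mainDet_add_two, h] using hp

/-- When the first block has one vertex, `-1` is a simple root of `mainDet a (n + 1)`. -/
theorem exists_mainDet_eq_mul {a : ℕ → ℕ} {n : ℕ}
    (ha : ∀ i, 1 ≤ i → i ≤ n + 1 → 0 < a i) (h1 : a 1 = 1) :
    ∃ g : ℝ[X], mainDet a (n + 1) = (X + 1) * g ∧ g.eval (-1) ≠ 0 := by
  induction n using Nat.twoStepInduction with
  | zero => exact ⟨1, by simp [mainDet_one, h1], by simp⟩
  | one =>
    refine ⟨X - (a 2 : ℝ[X]), ?_, ?_⟩
    · simp only [mainDet_add_two a 0, mainDet_zero, zero_add, mainDet_one, h1]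
      push_cast
      ring
    · have : (0 : ℝ) ≤ a 2 := Nat.cast_nonneg _
      simp
      linarith
  | more n ih1 ih2 =>
    obtain ⟨g, hg, -⟩ := ih1 fun i h1 h2 => ha i h1 (by omega)
    obtain ⟨g', hg', h'⟩ := ih2 fun i h1 h2 => ha i h1 (by omega)
    have hp := (ha (n + 3) (by omega) le_rfl).ne'
    refine ⟨X * (X + 1) * g - (-1) ^ (n + 1) * (a (n + 3) : ℝ[X]) * g', ?_, ?_⟩
    · rw [mainDet_add_two a (n + 1), hg, hg']
      ring
    · simpa [h'] using hp

theorem rootMultiplicity_mul_of_eval_ne_zero {r : ℝ} {p g : ℝ[X]} {k : ℕ}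
    (hp : p = (X - C r) ^ k * g) (hg : g.eval r ≠ 0) : p.rootMultiplicity r = k := by
  have h0 : (X - C r) ^ k * g ≠ 0 :=
    mul_ne_zero (pow_ne_zero _ (X_sub_C_ne_zero r)) (by rintro rfl; simp at hg)
  rw [hp, rootMultiplicity_mul h0, rootMultiplicity_X_sub_C_pow, rootMultiplicity_eq_zero hg,
    add_zero]

theorem theorem5 (n : ℕ) (hn : 2 ≤ n) (hev : Even n) (a : ℕ → ℕ)
    (ha : ∀ i : ℕ, 1 ≤ i → i ≤ n → 0 < a i)
    {V : Type*} [Fintype V] [DecidableEq V] (G : SimpleGraph V) [DecidableRel G.Adj]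
    (hG : Nonempty (G ≃g thresholdGraph n a)) :
    (1 < a 1 →
      graphPoly G =
        (-1 : Polynomial ℝ) ^ (∑ i ∈ Finset.Icc 1 n, a i) * Polynomial.X ^ eigMult G 0 *
          (Polynomial.X + 1) ^ eigMult G (-1) * Qpoly a n) ∧
    (a 1 = 1 →
      1 ≤ eigMult G (-1) ∧
      graphPoly G =
        (-1 : Polynomial ℝ) ^ (∑ i ∈ Finset.Icc 1 n, a i) * Polynomial.X ^ eigMult G 0 *
          (Polynomial.X + 1) ^ (eigMult G (-1) - 1) * Qpoly a n) := by
  obtain ⟨m, rfl⟩ : ∃ m, n = 2 * (m + 1) := by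
    obtain ⟨k, rfl⟩ := hev
    exact ⟨k - 1, by omega⟩
  obtain ⟨e⟩ := hG
  obtain ⟨s, t, hst⟩ := exists_prod_eq a (2 * (m + 1))
  have hP := graphPoly_eq ha e
  rw [hst, ← Qpoly_two_mul] at hP
  have hQ : Qpoly a (2 * (m + 1)) = mainDet a (2 * m + 1 + 1) := by
    rw [Qpoly_two_mul, ← mainDet_two_mul]
    rfl
  have hs : eigMult G 0 = s := by
    refine rootMultiplicity_mul_of_eval_ne_zero
      (g := (-1) ^ (∑ i ∈ Finset.Icc 1 (2 * (m + 1)), a i) *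
        ((X + 1) ^ t * Qpoly a (2 * (m + 1)))) (by rw [hP, C_0, sub_zero]; ring) ?_
    have h0 : (mainDet a (2 * m + 1 + 1)).eval 0 ≠ 0 := eval_zero_mainDet_ne_zero ha
    simpa [hQ] using h0
  have hX : (X - C (-1) : ℝ[X]) = X + 1 := by simp
  refine ⟨fun h1 => ?_, fun h1 => ?_⟩
  · have ht : eigMult G (-1) = t := by
      refine rootMultiplicity_mul_of_eval_ne_zero
        (g := (-1) ^ (∑ i ∈ Finset.Icc 1 (2 * (m + 1)), a i) *
          (X ^ s * Qpoly a (2 * (m + 1)))) (by rw [hP, hX]; ring) ?_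
      simpa [hQ] using eval_neg_one_mainDet_ne_zero ha h1
    rw [hs, ht, hP]
    ring
  · obtain ⟨g, hg, hg'⟩ := exists_mainDet_eq_mul (n := 2 * m + 1) ha h1
    have ht : eigMult G (-1) = t + 1 := by
      refine rootMultiplicity_mul_of_eval_ne_zero
        (g := (-1) ^ (∑ i ∈ Finset.Icc 1 (2 * (m + 1)), a i) *
          (X ^ s * g)) (by rw [hP, hX, hQ, hg]; ring) ?_
      simpa using hg'
    refine ⟨by omega, ?_⟩
    rw [hs, ht, hP, Nat.add_sub_cancel]
    ring
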